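/- Let $n\ge 1$. The Kneser graph $K(2n+1,n)$ has as its vertex set the set $X$ of $n$-element subsets of $\{1,\dots,2n+1\}$, two vertices being adjacent exactly when they are disjoint; let $T$ be its adjacency matrix, regarded as an operator on $\ell^2(X)$. For a complex $X\times X$ matrix $A=[a_{xy}]$, let $S_A$ be the Schur multiplier $S_A([m_{xy}])=[a_{xy}m_{xy}]$ on $\mathcal B(\ell^2(X))$, and let $\|A\|_m$ be its norm when $\mathcal B(\ell^2(X))$ carries the operator norm. Let $\pi$ be the permutation representation $\pi(g)e_x=e_{g(x)}$ of the symmetric group $\mathfrak S_{2n+1}$ on $\ell^2(X)$, and let $\mathcal T$ be the commutant of $\pi(\mathfrak S_{2n+1})$ in $\mathcal B(\ell^2(X))$, with the operator norm. Then \[ \|T\|_m=\bigl\|S_T|_{\mathcal T}\bigr\|=\frac{2^{2n}}{\binom{2n+1}{n}} =\frac{4\cdot 6\cdots(2n+2)}{3\cdot 5\cdots(2n+1)} =\prod_{i=1}^{n}\Bigl(1+\frac1{2i+1}\Bigr)>\frac12\log(2n+3). \] -/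

import Mathlib

-- Square matrices carry the operator norm of `B(ℓ²(X))` (the `ℓ²`-operator norm).
open scoped Matrix.Norms.L2Operator Matrix

namespace SchurKneser

noncomputable section

section General

variable {X : Type*} [Fintype X] [DecidableEq X]

/-- The Schur (Hadamard) multiplier `S_A : B(ℓ²(X)) → B(ℓ²(X))`, `S_A(M) = [a_{ij} m_{ij}]`,
as a (bounded) linear operator on the complex `X × X` matrices. -/
def schurMultiplier (A : Matrix X X ℂ) : Matrix X X ℂ →L[ℂ] Matrix X X ℂ :=
  LinearMap.toContinuousLinearMap
    { toFun := fun M => A ⊙ M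
      map_add' := fun M N => Matrix.hadamard_add A M N
      map_smul' := fun c M => Matrix.hadamard_smul A M c }

/-- The Schur multiplier norm `‖A‖_m`: the operator norm of `S_A`, where `B(ℓ²(X))`
has its operator norm. -/
def schurNorm (A : Matrix X X ℂ) : ℝ := ‖schurMultiplier A‖

/-- The norm of the restriction of `S_A` to a linear space of matrices. -/
def schurNormOn (A : Matrix X X ℂ) (V : Submodule ℂ (Matrix X X ℂ)) : ℝ :=
  ‖(schurMultiplier A).comp V.subtypeL‖

/-- The permutation representation `π(g) e_x = e_{g • x}` of a group acting on `X`, by matrices. -/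
def permRep (G : Type*) (X : Type*) [Fintype X] [DecidableEq X] [Group G] [MulAction G X] :
    G →* Matrix X X ℂ :=
  Matrix.permMatrixHom.comp (MulAction.toPermHom G X)

/-- The commutant of `π(G)`: all matrices commuting with every `π(g)`. -/
def commutant (G : Type*) (X : Type*) [Fintype X] [DecidableEq X] [Group G] [MulAction G X] :
    Subalgebra ℂ (Matrix X X ℂ) :=
  Subalgebra.centralizer ℂ (Set.range (permRep G X))

end General

instance (v n : ℕ) : DecidableEq (Set.powersetCard (Fin v) n) := Classical.decEq _

/-- The Kneser graph `K(v,n)`: the vertices are the `n`-element subsets of a `v`-element set;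
two distinct vertices are adjacent when they are disjoint. (For `n ≥ 1` disjoint vertices are
automatically distinct.) -/
def kneserGraph (v n : ℕ) : SimpleGraph (Set.powersetCard (Fin v) n) where
  Adj A B := A ≠ B ∧ Disjoint (A : Finset (Fin v)) (B : Finset (Fin v))
  symm := ⟨fun _ _ h => ⟨h.1.symm, h.2.symm⟩⟩
  loopless := ⟨fun _ h => h.1 rfl⟩

instance (v n : ℕ) : DecidableRel (kneserGraph v n).Adj := Classical.decRel _

/-- The complex adjacency matrix of the Kneser graph `K(v,n)`. -/
def kneserMatrix (v n : ℕ) :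
    Matrix (Set.powersetCard (Fin v) n) (Set.powersetCard (Fin v) n) ℂ :=
  (kneserGraph v n).adjMatrix ℂ

/-- The commutant of the natural action of the symmetric group on the `n`-element subsets of
a `v`-element set. -/
def kneserCommutant (v n : ℕ) :
    Subalgebra ℂ (Matrix (Set.powersetCard (Fin v) n) (Set.powersetCard (Fin v) n) ℂ) :=
  commutant (Equiv.Perm (Fin v)) (Set.powersetCard (Fin v) n)

end

end SchurKneser

namespace SchurKneser

/-! ### Schur multiplier norm as a normalized trace norm. -/

section General

variable {X : Type*} [Fintype X] [DecidableEq X]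

/-! Diagonalizing a Hermitian `T` writes `S_T(M)` as `∑ λ_k D_k M D_k*` with `D_k` diagonal, so
Cauchy–Schwarz bounds `‖T‖_m` by the largest diagonal entry of `|T|`. If a transitive group
preserves `T`, the diagonal of `|T|` is constant, equal to `tr|T| / |X|`. Conversely `sgn T` is a
contraction in the commutant, and testing `T ⊙ sgn T` on the all-ones vector returns `tr|T| / |X|`.
Hence both norms equal this number (`schurNorm_eq_of_isPretransitive`).

For `K(2n+1,n)`, complementing the column index turns `T` into the inclusion matrix `W` between
layers `n` and `n+1`, so `T² = W Wᵀ`. The commutation relation of consecutive inclusion matrices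
gives its spectrum by induction on the layer: `(n+1-i)²` with multiplicity `C(2n+1,i) -
C(2n+1,i-1)`. Summation by parts gives `tr|T| = ∑_{i≤n} C(2n+1,i) = 2^(2n)`. -/

lemma norm_sum_star_mul_mul_le (M : Matrix X X ℂ) (u v : X → ℂ) :
    ‖∑ x, ∑ y, star (u x) * M x y * v y‖ ≤
      ‖M‖ * ‖WithLp.toLp 2 u‖ * ‖WithLp.toLp 2 v‖ := by
  have h : ∑ x, ∑ y, star (u x) * M x y * v y
      = inner ℂ (WithLp.toLp 2 u) (WithLp.toLp 2 (M *ᵥ v)) := by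
    rw [EuclideanSpace.inner_toLp_toLp]
    simp only [dotProduct, Matrix.mulVec, Finset.sum_mul, Pi.star_apply]
    refine Finset.sum_congr rfl fun x _ => Finset.sum_congr rfl fun y _ => by ring
  rw [h]
  refine (norm_inner_le_norm _ _).trans ?_
  have := Matrix.l2_opNorm_mulVec M (WithLp.toLp 2 v)
  calc _ ≤ ‖WithLp.toLp 2 u‖ * (‖M‖ * ‖WithLp.toLp 2 v‖) := by gcongr; exact this
    _ = _ := by ring

lemma l2_opNorm_le_of_forall (M : Matrix X X ℂ) {c : ℝ} (hc : 0 ≤ c)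
    (h : ∀ u v : X → ℂ, ‖∑ x, ∑ y, star (u x) * M x y * v y‖ ≤
      c * ‖WithLp.toLp 2 u‖ * ‖WithLp.toLp 2 v‖) : ‖M‖ ≤ c := by
  rw [Matrix.cstar_norm_def]
  refine ContinuousLinearMap.opNorm_le_bound _ hc fun w => ?_
  obtain ⟨v, rfl⟩ : ∃ v : X → ℂ, w = WithLp.toLp 2 v := ⟨w, rfl⟩
  rw [Matrix.toEuclideanCLM_toLp]
  -- The choice `u = M v` turns the hypothesis into `‖M v‖² ≤ c ‖M v‖ ‖v‖`.
  have h1 := h (M *ᵥ v) v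
  have h2 : ∑ x, ∑ y, star ((M *ᵥ v) x) * M x y * v y
      = inner ℂ (WithLp.toLp 2 (M *ᵥ v)) (WithLp.toLp 2 (M *ᵥ v)) := by
    rw [EuclideanSpace.inner_toLp_toLp]
    refine Finset.sum_congr rfl fun x _ => ?_
    calc _ = star ((M *ᵥ v) x) * ∑ y, M x y * v y := by
          rw [Finset.mul_sum]
          exact Finset.sum_congr rfl fun y _ => mul_assoc _ _ _
      _ = _ := mul_comm _ _
  rw [h2, inner_self_eq_norm_sq_to_K] at h1
  simp only [norm_pow, RCLike.norm_ofReal, abs_norm] at h1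
  rcases (norm_nonneg (WithLp.toLp 2 (M *ᵥ v))).eq_or_lt with h0 | h0
  · rw [← h0]; positivity
  · nlinarith

lemma cfc_apply_apply {T : Matrix X X ℂ} (hT : T.IsHermitian) (f : ℝ → ℝ) (x y : X) :
    cfc f T x y = ∑ k, (hT.eigenvectorUnitary : Matrix X X ℂ) x k * (f (hT.eigenvalues k) : ℂ) *
      star ((hT.eigenvectorUnitary : Matrix X X ℂ) y k) := by
  rw [hT.cfc_eq, Matrix.IsHermitian.cfc, Unitary.conjStarAlgAut_apply, Matrix.mul_apply]
  refine Finset.sum_congr rfl fun k _ => ?_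
  rw [Matrix.mul_diagonal]
  rfl

lemma trace_cfc {T : Matrix X X ℂ} (hT : T.IsHermitian) (f : ℝ → ℝ) :
    (cfc f T).trace = ∑ k, (f (hT.eigenvalues k) : ℂ) := by
  rw [hT.cfc_eq, Matrix.IsHermitian.cfc, Unitary.conjStarAlgAut_apply, Matrix.trace_mul_comm,
    ← mul_assoc, Unitary.coe_star_mul_self, one_mul, Matrix.trace_diagonal]
  rfl

lemma l2_opNorm_cfc_le {T : Matrix X X ℂ} (hT : T.IsHermitian) (f : ℝ → ℝ)
    (hf : ∀ t, |f t| ≤ 1) : ‖cfc f T‖ ≤ 1 := by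
  rw [hT.cfc_eq, Matrix.IsHermitian.cfc, Unitary.conjStarAlgAut_apply]
  rw [← Unitary.coe_star, CStarRing.norm_mul_coe_unitary, CStarRing.norm_coe_unitary_mul,
    Matrix.l2_opNorm_diagonal]
  refine (pi_norm_le_iff_of_nonneg zero_le_one).2 fun k => ?_
  simpa using hf _

/-- A Hermitian matrix whose absolute value has diagonal entries at most `c` has Schur norm
at most `c`. -/
theorem schurNorm_le_of_abs_diag {T : Matrix X X ℂ} (hT : T.IsHermitian) {c : ℝ} (hc : 0 ≤ c)
    (h : ∀ x, ((cfc (fun t : ℝ => |t|) T) x x).re ≤ c) : schurNorm T ≤ c := by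
  refine ContinuousLinearMap.opNorm_le_bound _ hc fun M => ?_
  change ‖T ⊙ M‖ ≤ _
  refine l2_opNorm_le_of_forall _ (by positivity) fun u v => ?_
  set V := (hT.eigenvectorUnitary : Matrix X X ℂ) with hV
  set l := hT.eigenvalues with hl
  have hdiag : ∀ x, ∑ k, |l k| * ‖V x k‖ ^ 2 ≤ c := by
    intro x
    refine le_trans (le_of_eq ?_) (h x)
    rw [cfc_apply_apply hT, Complex.re_sum]
    refine Finset.sum_congr rfl fun k _ => ?_
    rw [mul_right_comm, ← hV, ← hl, Complex.star_def, Complex.mul_conj, ← Complex.ofReal_mul,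
      Complex.ofReal_re, Complex.normSq_eq_norm_sq, mul_comm]
  have hTe : ∀ x y, T x y = ∑ k, V x k * (l k : ℂ) * star (V y k) := by
    intro x y
    have := cfc_apply_apply hT (fun t => t) x y
    rwa [cfc_id' ℝ T hT.isSelfAdjoint] at this
  let a : X → X → ℂ := fun k x => u x * star (V x k)
  let b : X → X → ℂ := fun k y => v y * star (V y k)
  have hsum : ∑ x, ∑ y, star (u x) * (T ⊙ M) x y * v y
      = ∑ k, (l k : ℂ) * ∑ x, ∑ y, star (a k x) * M x y * b k y := by
    simp only [Matrix.hadamard_apply, hTe, Finset.mul_sum, Finset.sum_mul]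
    rw [Finset.sum_comm' (t' := Finset.univ) (s' := fun _ => Finset.univ) (by simp)]
    simp only [a, b]
    rw [Finset.sum_comm]
    conv_rhs => rw [Finset.sum_comm]
    refine Finset.sum_congr rfl fun x _ => ?_
    rw [Finset.sum_comm]
    refine Finset.sum_congr rfl fun k _ => Finset.sum_congr rfl fun y _ => ?_
    simp only [star_mul', star_star]
    ring
  have hvec : ∀ w : X → ℂ, ∑ k, |l k| * ‖WithLp.toLp 2 (fun x => w x * star (V x k))‖ ^ 2
      ≤ c * ‖WithLp.toLp 2 w‖ ^ 2 := by
    intro w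
    simp only [EuclideanSpace.norm_sq_eq, Finset.mul_sum]
    rw [Finset.sum_comm]
    refine Finset.sum_le_sum fun x _ => ?_
    simp only [norm_mul, norm_star, mul_pow]
    calc _ = (∑ k, |l k| * ‖V x k‖ ^ 2) * ‖w x‖ ^ 2 := by
          rw [Finset.sum_mul]
          exact Finset.sum_congr rfl fun k _ => by ring
      _ ≤ _ := by gcongr; exact hdiag x
  rw [hsum]
  -- Splitting the weight `|λ_k|` evenly lets Cauchy–Schwarz over `k` use `hvec` for `u` and for
  -- `v`.
  have hCS : ∑ k, (√|l k| * ‖WithLp.toLp 2 (a k)‖) * (√|l k| * ‖WithLp.toLp 2 (b k)‖)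
      ≤ c * ‖WithLp.toLp 2 u‖ * ‖WithLp.toLp 2 v‖ := by
    refine abs_le_of_sq_le_sq' ?_ (by positivity) |>.2
    refine (Finset.sum_mul_sq_le_sq_mul_sq _ _ _).trans ?_
    simp only [mul_pow, Real.sq_sqrt (abs_nonneg _)]
    calc _ ≤ (c * ‖WithLp.toLp 2 u‖ ^ 2) * (c * ‖WithLp.toLp 2 v‖ ^ 2) :=
          mul_le_mul (hvec u) (hvec v) (Finset.sum_nonneg fun k _ => by positivity)
            (by positivity)
      _ = _ := by ring
  calc _ ≤ ∑ k, |l k| * (‖M‖ * ‖WithLp.toLp 2 (a k)‖ * ‖WithLp.toLp 2 (b k)‖) := by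
        refine (norm_sum_le _ _).trans (Finset.sum_le_sum fun k _ => ?_)
        rw [norm_mul, Complex.norm_real, Real.norm_eq_abs]
        gcongr
        exact norm_sum_star_mul_mul_le M _ _
    _ = ‖M‖ * ∑ k, (√|l k| * ‖WithLp.toLp 2 (a k)‖) * (√|l k| * ‖WithLp.toLp 2 (b k)‖) := by
        rw [Finset.mul_sum]
        refine Finset.sum_congr rfl fun k _ => ?_
        nth_rw 1 [← Real.mul_self_sqrt (abs_nonneg (l k))]
        ring
    _ ≤ ‖M‖ * (c * ‖WithLp.toLp 2 u‖ * ‖WithLp.toLp 2 v‖) := by gcongr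
    _ = _ := by ring

lemma schurNormOn_le_schurNorm (A : Matrix X X ℂ) (V : Submodule ℂ (Matrix X X ℂ)) :
    schurNormOn A V ≤ schurNorm A := by
  refine (ContinuousLinearMap.opNorm_comp_le _ _).trans ?_
  exact mul_le_of_le_one_right (norm_nonneg _) V.norm_subtypeL_le

lemma mem_commutant_iff {G : Type*} [Group G] [MulAction G X] {M : Matrix X X ℂ} :
    M ∈ commutant G X ↔ ∀ g : G, ∀ x y, M (g • x) (g • y) = M x y := by
  have hp : ∀ g : G, permRep G X g = ((MulAction.toPerm g)⁻¹).permMatrix ℂ := fun g => rfl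
  rw [commutant, Subalgebra.mem_centralizer_iff]
  simp only [Set.forall_mem_range, hp, Equiv.Perm.permMatrix,
    PEquiv.toMatrix_toPEquiv_mul, PEquiv.mul_toMatrix_toPEquiv]
  refine forall_congr' fun g => ?_
  rw [← Matrix.ext_iff]
  have hg : ∀ y : X, (MulAction.toPerm g)⁻¹.symm y = g • y := fun _ => rfl
  have hg' : ∀ y : X, (MulAction.toPerm g)⁻¹ y = g⁻¹ • y := fun _ => rfl
  simp only [Matrix.submatrix_apply, id, hg, hg']
  constructor
  · intro h x y
    simpa using (h (g • x) y).symm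
  · intro h x y
    simpa using (h (g⁻¹ • x) y).symm

lemma cfc_mem_commutant {G : Type*} [Group G] [MulAction G X] {T : Matrix X X ℂ}
    (hT : T.IsHermitian) (h : T ∈ commutant G X) (f : ℝ → ℝ) : cfc f T ∈ commutant G X := by
  rw [commutant, Subalgebra.mem_centralizer_iff] at h ⊢
  intro M hM
  have hc : Commute T M := (h M hM).symm
  exact (Commute.cfc hc (by rwa [hT.isSelfAdjoint.star_eq]) f).symm.eq

/-- For a symmetric Hermitian matrix, the normalized trace norm is a lower bound of the norm of
the Schur multiplier on any space containing the sign of the matrix. -/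
theorem le_schurNormOn [Nonempty X] {T : Matrix X X ℂ} (hT : T.IsHermitian) (hs : T.IsSymm)
    (V : Submodule ℂ (Matrix X X ℂ))
    (hV : cfc (fun t : ℝ => if 0 ≤ t then (1 : ℝ) else -1) T ∈ V) :
    (∑ k, |hT.eigenvalues k|) / Fintype.card X ≤ schurNormOn T V := by
  set s : ℝ → ℝ := fun t : ℝ => if 0 ≤ t then (1 : ℝ) else -1 with hsdef
  set A := cfc s T with hA
  have hA1 : ‖A‖ ≤ 1 := l2_opNorm_cfc_le hT _ fun t => by
    simp only [hsdef]; split_ifs <;> simp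
  have h1 : ‖T ⊙ A‖ ≤ schurNormOn T V := by
    have := ((schurMultiplier T).comp V.subtypeL).le_opNorm ⟨A, hV⟩
    refine this.trans (mul_le_of_le_one_right (norm_nonneg _) hA1)
  have h2 : ∑ x, ∑ y, (T ⊙ A) x y = ((∑ k, |hT.eigenvalues k| : ℝ) : ℂ) := by
    -- Symmetry of `T`, not only Hermiticity, is what makes the entry sum a trace.
    have ht : ∑ x, ∑ y, (T ⊙ A) x y = (A * T).trace := by
      refine Finset.sum_congr rfl fun x _ => ?_
      rw [Matrix.diag_apply, Matrix.mul_apply]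
      refine Finset.sum_congr rfl fun y _ => ?_
      rw [Matrix.hadamard_apply, hs.apply, mul_comm]
    have hmul : A * T = cfc (fun t => s t * t) T := by
      -- The spectrum is finite, so the discontinuous sign function is admissible.
      have hfin : ∀ f : ℝ → ℝ, ContinuousOn f (spectrum ℝ T) := fun f =>
        T.finite_real_spectrum.continuousOn f
      rw [cfc_mul s (fun t => t) T (hfin _) (hfin _), cfc_id' ℝ T hT.isSelfAdjoint]
    rw [ht, hmul, trace_cfc hT, Complex.ofReal_sum]
    refine Finset.sum_congr rfl fun k _ => ?_
    congr 1
    simp only [hsdef]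
    split_ifs with h0
    · rw [one_mul, abs_of_nonneg h0]
    · rw [neg_one_mul, abs_of_neg (not_le.1 h0)]
  have h3 := norm_sum_star_mul_mul_le (T ⊙ A) (fun _ => 1) (fun _ => 1)
  simp only [star_one, one_mul, mul_one] at h3
  rw [h2, Complex.norm_real, Real.norm_of_nonneg (Finset.sum_nonneg fun k _ => abs_nonneg _),
    mul_assoc, ← sq, EuclideanSpace.norm_sq_eq] at h3
  simp only [norm_one, one_pow, Finset.sum_const, Finset.card_univ, nsmul_eq_mul, mul_one] at h3
  have hX : (0 : ℝ) < Fintype.card X := by exact_mod_cast Fintype.card_pos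
  rw [div_le_iff₀ hX]
  exact h3.trans (by gcongr)

/-- The Schur norm of a real symmetric matrix invariant under a transitive group action is its
normalized trace norm, and is attained on the commutant. -/
theorem schurNorm_eq_of_isPretransitive {G : Type*} [Group G] [MulAction G X] [Nonempty X]
    [MulAction.IsPretransitive G X] {T : Matrix X X ℂ} (hT : T.IsHermitian) (hs : T.IsSymm)
    (h : T ∈ commutant G X) :
    schurNorm T = (∑ k, |hT.eigenvalues k|) / Fintype.card X ∧
      schurNormOn T (Subalgebra.toSubmodule (commutant G X)) =
        (∑ k, |hT.eigenvalues k|) / Fintype.card X := by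
  have hX : (0 : ℝ) < Fintype.card X := by exact_mod_cast Fintype.card_pos
  have hup : schurNorm T ≤ (∑ k, |hT.eigenvalues k|) / Fintype.card X := by
    refine schurNorm_le_of_abs_diag hT (by positivity) fun x => ?_
    have hP := mem_commutant_iff.1 (cfc_mem_commutant hT h (fun t : ℝ => |t|))
    have htr := congrArg Complex.re (trace_cfc hT (fun t : ℝ => |t|))
    have hconst : ∀ y, cfc (fun t : ℝ => |t|) T y y = cfc (fun t : ℝ => |t|) T x x := by
      intro y
      obtain ⟨g, rfl⟩ := MulAction.exists_smul_eq G x y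
      exact hP g x x
    simp only [Matrix.trace, Matrix.diag_apply, hconst, Finset.sum_const, Finset.card_univ,
      nsmul_eq_mul, ← Complex.ofReal_sum, Complex.ofReal_re] at htr
    rw [le_div_iff₀ hX, ← htr, mul_comm]
    simp
  have hlow := le_schurNormOn hT hs (Subalgebra.toSubmodule (commutant G X))
    (cfc_mem_commutant hT h _)
  have hle := schurNormOn_le_schurNorm T (Subalgebra.toSubmodule (commutant G X))
  exact ⟨le_antisymm hup (hlow.trans hle), le_antisymm (hle.trans hup) hlow⟩

end General

end SchurKneser

namespace SchurKneser

/-! ### Spectrum of the inclusion matrices of the Boolean lattice. -/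

section Layers

open Finset Polynomial

/-- The inclusion matrix between the `j`-element and the `k`-element subsets of `Fin N`. -/
def inclusionMatrix (N j k : ℕ) :
    Matrix (Set.powersetCard (Fin N) j) (Set.powersetCard (Fin N) k) ℂ :=
  Matrix.of fun x z => if (x : Finset (Fin N)) ⊆ (z : Finset (Fin N)) then 1 else 0

lemma card_powersetCard_fin (N j : ℕ) : Fintype.card (Set.powersetCard (Fin N) j) = N.choose j := by
  rw [← Nat.card_eq_fintype_card, Set.powersetCard.card, Nat.card_eq_fintype_card,
    Fintype.card_fin]

/-- A set one larger containing `x` is `x ∪ {a}` with `a ∉ x`; it contains `y` exactly when `y \ x ⊆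
{a}`. -/
lemma card_filter_supersets {N j : ℕ} (x y : Set.powersetCard (Fin N) j) :
    #{z : Set.powersetCard (Fin N) (j + 1) |
        (x : Finset (Fin N)) ⊆ (z : Finset (Fin N)) ∧ (y : Finset (Fin N)) ⊆ (z : Finset (Fin N))}
      = #{a ∈ (x : Finset (Fin N))ᶜ | (y : Finset (Fin N)) \ x ⊆ {a}} := by
  symm
  refine Finset.card_bij (fun a ha => ⟨insert a (x : Finset (Fin N)), ?_⟩) ?_ ?_ ?_
  · rw [Set.powersetCard.mem_iff, card_insert_of_notMem (by simpa using (mem_filter.1 ha).1),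
      Set.powersetCard.card_eq]
  · intro a ha
    simp only [mem_filter, mem_univ, true_and, mem_compl] at ha ⊢
    refine ⟨subset_insert _ _, fun b hb => ?_⟩
    by_cases hbx : b ∈ (x : Finset (Fin N))
    · exact mem_insert_of_mem hbx
    · exact mem_insert.2 (Or.inl (mem_singleton.1 (ha.2 (mem_sdiff.2 ⟨hb, hbx⟩))))
  · intro a ha b hb hab
    simp only [mem_filter, mem_compl] at ha hb
    have h : insert a (x : Finset (Fin N)) = insert b (x : Finset (Fin N)) := Subtype.ext_iff.1 hab
    have : a ∈ insert b (x : Finset (Fin N)) := h ▸ mem_insert_self _ _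
    exact (mem_insert.1 this).resolve_right ha.1
  · intro z hz
    simp only [mem_filter, mem_univ, true_and] at hz
    have hc : #((z : Finset (Fin N)) \ x) = 1 := by
      rw [card_sdiff_of_subset hz.1, Set.powersetCard.card_eq, Set.powersetCard.card_eq]; omega
    obtain ⟨a, ha⟩ := card_eq_one.1 hc
    have ha' : a ∈ (z : Finset (Fin N)) \ x := ha ▸ mem_singleton_self a
    refine ⟨a, ?_, ?_⟩
    · simp only [mem_filter, mem_compl]
      exact ⟨(mem_sdiff.1 ha').2, ha ▸ sdiff_subset_sdiff hz.2 subset_rfl⟩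
    · apply Subtype.ext
      change insert a (x : Finset (Fin N)) = z
      rw [insert_eq, ← ha, sdiff_union_of_subset hz.1]

lemma card_filter_subsets {N j : ℕ} (x y : Set.powersetCard (Fin N) (j + 1)) :
    #{w : Set.powersetCard (Fin N) j |
        (w : Finset (Fin N)) ⊆ (x : Finset (Fin N)) ∧ (w : Finset (Fin N)) ⊆ (y : Finset (Fin N))}
      = #{b ∈ (x : Finset (Fin N)) | (x : Finset (Fin N)) \ y ⊆ {b}} := by
  symm
  refine Finset.card_bij (fun b hb => ⟨(x : Finset (Fin N)).erase b, ?_⟩) ?_ ?_ ?_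
  · rw [Set.powersetCard.mem_iff, card_erase_of_mem (mem_filter.1 hb).1,
      Set.powersetCard.card_eq]; rfl
  · intro b hb
    simp only [mem_filter, mem_univ, true_and] at hb ⊢
    refine ⟨erase_subset _ _, fun c hc => ?_⟩
    by_contra hcy
    have := hb.2 (mem_sdiff.2 ⟨mem_of_mem_erase hc, hcy⟩)
    exact ne_of_mem_erase hc (mem_singleton.1 this)
  · intro a ha b hb hab
    simp only [mem_filter] at ha hb
    have h : (x : Finset (Fin N)).erase a = (x : Finset (Fin N)).erase b := Subtype.ext_iff.1 hab
    by_contra hne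
    have : a ∈ (x : Finset (Fin N)).erase b := mem_erase.2 ⟨hne, ha.1⟩
    rw [← h] at this
    exact notMem_erase _ _ this
  · intro w hw
    simp only [mem_filter, mem_univ, true_and] at hw
    have hc : #((x : Finset (Fin N)) \ w) = 1 := by
      rw [card_sdiff_of_subset hw.1, Set.powersetCard.card_eq, Set.powersetCard.card_eq]; omega
    obtain ⟨b, hb⟩ := card_eq_one.1 hc
    have hb' : b ∈ (x : Finset (Fin N)) \ w := hb ▸ mem_singleton_self b
    refine ⟨b, ?_, ?_⟩
    · simp only [mem_filter]
      exact ⟨(mem_sdiff.1 hb').1, hb ▸ sdiff_subset_sdiff subset_rfl hw.2⟩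
    · apply Subtype.ext
      change (x : Finset (Fin N)).erase b = w
      rw [erase_eq, ← hb, Finset.sdiff_sdiff_eq_self hw.1]

lemma card_filter_subset_singleton {α : Type*} [DecidableEq α] {s t : Finset α} (hts : t ⊆ s)
    (ht : t.Nonempty) : #{a ∈ s | t ⊆ {a}} = if #t = 1 then 1 else 0 := by
  split_ifs with h
  · obtain ⟨b, rfl⟩ := card_eq_one.1 h
    rw [card_eq_one]
    refine ⟨b, ?_⟩
    ext a
    simp only [mem_filter, singleton_subset_singleton, mem_singleton]
    exact ⟨fun h => h.2.symm, fun h => ⟨h ▸ hts (mem_singleton_self b), h.symm⟩⟩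
  · rw [card_eq_zero, filter_eq_empty_iff]
    intro a _ hta
    exact h (le_antisymm ((card_le_card hta).trans_eq (card_singleton a)) ht.card_pos)

lemma inclusionMatrix_mul_transpose_apply {N j k : ℕ} (x y : Set.powersetCard (Fin N) j) :
    (inclusionMatrix N j k * (inclusionMatrix N j k)ᵀ) x y =
      (#{z : Set.powersetCard (Fin N) k | (x : Finset (Fin N)) ⊆ (z : Finset (Fin N)) ∧
        (y : Finset (Fin N)) ⊆ (z : Finset (Fin N))} : ℂ) := by
  rw [Matrix.mul_apply, card_filter, Nat.cast_sum]
  refine sum_congr rfl fun z _ => ?_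
  simp only [inclusionMatrix, Matrix.transpose_apply, Matrix.of_apply, ← ite_and, mul_ite, mul_one,
    mul_zero, Nat.cast_ite, Nat.cast_one, Nat.cast_zero, and_comm]

lemma transpose_mul_inclusionMatrix_apply {N j k : ℕ} (x y : Set.powersetCard (Fin N) k) :
    ((inclusionMatrix N j k)ᵀ * inclusionMatrix N j k) x y =
      (#{w : Set.powersetCard (Fin N) j | (w : Finset (Fin N)) ⊆ (x : Finset (Fin N)) ∧
        (w : Finset (Fin N)) ⊆ (y : Finset (Fin N))} : ℂ) := by
  rw [Matrix.mul_apply, card_filter, Nat.cast_sum]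
  refine sum_congr rfl fun z _ => ?_
  simp only [inclusionMatrix, Matrix.transpose_apply, Matrix.of_apply, ← ite_and, mul_ite, mul_one,
    mul_zero, Nat.cast_ite, Nat.cast_one, Nat.cast_zero, and_comm]

/-- The commutation relation of the raising and lowering operators of the Boolean lattice. -/
lemma inclusionMatrix_mul_transpose_succ (N j : ℕ) :
    inclusionMatrix N (j + 1) (j + 2) * (inclusionMatrix N (j + 1) (j + 2))ᵀ =
      (inclusionMatrix N j (j + 1))ᵀ * inclusionMatrix N j (j + 1) +
        Matrix.scalar _ ((N : ℂ) - 2 * (j + 1)) := by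
  ext x y
  rw [Matrix.add_apply, inclusionMatrix_mul_transpose_apply, transpose_mul_inclusionMatrix_apply,
    card_filter_supersets, card_filter_subsets, Matrix.scalar_apply, Matrix.diagonal_apply]
  have hcx : #(x : Finset (Fin N)) = j + 1 := Set.powersetCard.card_eq x
  have hcy : #(y : Finset (Fin N)) = j + 1 := Set.powersetCard.card_eq y
  by_cases hxy : x = y
  · subst hxy
    have hle : j + 1 ≤ N := by
      have := card_le_univ (x : Finset (Fin N)); rwa [hcx, Fintype.card_fin] at this
    simp only [sdiff_self, bot_eq_empty, empty_subset, filter_true, card_compl, hcx,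
      Fintype.card_fin, if_true]
    push_cast [Nat.cast_sub hle]
    ring
  -- Off the diagonal, both counts are 1 or 0 according to whether the two equal-sized differences
  -- are singletons.
  · have h1 : #((x : Finset (Fin N)) \ y) = #((y : Finset (Fin N)) \ x) :=
      card_sdiff_comm (hcx.trans hcy.symm)
    have hne : ((x : Finset (Fin N)) \ y).Nonempty := by
      rw [sdiff_nonempty]
      exact fun h => hxy (Set.powersetCard.eq_iff_subset.2 h)
    have hne' : ((y : Finset (Fin N)) \ x).Nonempty := by
      rw [← card_pos, ← h1, card_pos]; exact hne
    rw [card_filter_subset_singleton (fun a ha => mem_compl.2 (mem_sdiff.1 ha).2) hne',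
      card_filter_subset_singleton sdiff_subset hne, h1, if_neg hxy, add_zero]

/-- The multiplicity of the `i`-th isotypic part of the permutation module on subsets. -/
def layerMult (N : ℕ) : ℕ → ℕ
  | 0 => 1
  | i + 1 => N.choose (i + 1) - N.choose i

lemma choose_le_choose_succ {N i : ℕ} (h : 2 * i + 1 ≤ N) : N.choose i ≤ N.choose (i + 1) := by
  refine Nat.le_of_mul_le_mul_right ?_ i.succ_pos
  rw [Nat.choose_succ_right_eq]
  exact Nat.mul_le_mul_left _ (by omega)

/-- The characteristic polynomial of `W Wᵀ`, `W` the inclusion matrix between consecutive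
layers of the Boolean lattice. -/
theorem charpoly_inclusionMatrix_mul_transpose (N j : ℕ) (hj : 2 * j ≤ N) :
    (inclusionMatrix N j (j + 1) * (inclusionMatrix N j (j + 1))ᵀ).charpoly =
      ∏ i ∈ range (j + 1),
        (X - C (((j : ℂ) + 1 - i) * ((N : ℂ) - i - j))) ^ layerMult N i := by
  induction j with
  | zero =>
    have hM : inclusionMatrix N 0 1 * (inclusionMatrix N 0 1)ᵀ = Matrix.scalar _ (N : ℂ) := by
      ext x y
      have hx : (x : Finset (Fin N)) = ∅ := card_eq_zero.1 (Set.powersetCard.card_eq x)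
      have hy : (y : Finset (Fin N)) = ∅ := card_eq_zero.1 (Set.powersetCard.card_eq y)
      have hxy : x = y := Subtype.ext (hx.trans hy.symm)
      subst hxy
      rw [inclusionMatrix_mul_transpose_apply, card_filter_supersets, Matrix.scalar_apply,
        Matrix.diagonal_apply_eq]
      simp [hx]
    have h1 : Fintype.card (Set.powersetCard (Fin N) 0) = 1 := by
      rw [card_powersetCard_fin, Nat.choose_zero_right]
    rw [zero_add, hM, Matrix.scalar_apply, Matrix.charpoly_diagonal]
    simp [h1, layerMult]
  | succ j ih =>
    have ih := ih (by omega)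
    set W := inclusionMatrix N j (j + 1) with hW
    have hle : Fintype.card (Set.powersetCard (Fin N) j) ≤
        Fintype.card (Set.powersetCard (Fin N) (j + 1)) := by
      rw [card_powersetCard_fin, card_powersetCard_fin]
      exact choose_le_choose_succ (by omega)
    -- `Wᵀ W` has the spectrum of `W Wᵀ` plus extra zeros. The shift by `N - 2(j+1)` makes those
    -- zeros the new factor `i = j+1`, and takes `(j+1-i)(N-i-j)` to `(j+2-i)(N-i-j-1)`.
    have hq := Matrix.charpoly_mul_comm_of_le Wᵀ W hle
    rw [ih, card_powersetCard_fin, card_powersetCard_fin] at hq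
    refine Polynomial.funext fun t => ?_
    rw [inclusionMatrix_mul_transpose_succ, Matrix.eval_charpoly]
    have hsub : Matrix.scalar _ t - (Wᵀ * W + Matrix.scalar _ ((N : ℂ) - 2 * (j + 1))) =
        Matrix.scalar _ (t - ((N : ℂ) - 2 * (j + 1))) - Wᵀ * W := by
      simp only [map_sub]; abel
    have hm : layerMult N (j + 1) = N.choose (j + 1) - N.choose j := rfl
    rw [hsub, ← Matrix.eval_charpoly, hq, prod_range_succ _ (j + 1), hm]
    simp only [eval_mul, eval_pow, eval_X, eval_prod, eval_sub, eval_C]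
    refine (mul_comm _ _).trans ?_
    congr 1
    · refine prod_congr rfl fun i _ => ?_
      congr 1
      push_cast
      ring
    · congr 1
      push_cast
      ring

/-- Summation by parts: the multiplicities up to `m` telescope to `C(N,m)`, and `n+1-i` counts the
`m` with `i ≤ m ≤ n`. The bound on `n` keeps the natural subtraction from truncating. -/
lemma sum_layerMult (N n : ℕ) (h : 2 * n ≤ N + 1) :
    ∑ i ∈ range (n + 1), (layerMult N i : ℝ) * ((n : ℝ) + 1 - i) =
      ∑ i ∈ range (n + 1), (N.choose i : ℝ) := by
  have hs : ∀ m, 2 * m ≤ N + 1 → ∑ i ∈ range (m + 1), (layerMult N i : ℝ) = N.choose m := by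
    intro m hm
    induction m with
    | zero => simp [layerMult]
    | succ m ih =>
      rw [sum_range_succ, ih (by omega)]
      simp only [layerMult]
      rw [Nat.cast_sub (choose_le_choose_succ (by omega))]
      ring
  induction n with
  | zero => simp [layerMult]
  | succ n ih =>
    rw [sum_range_succ (fun i => (N.choose i : ℝ)), ← ih (by omega), ← hs (n + 1) h,
      sum_range_succ, sum_range_succ _ (n + 1), ← add_assoc, ← sum_add_distrib]
    congr 1
    · refine sum_congr rfl fun i _ => ?_
      push_cast; ring
    · push_cast; ring

end Layers

end SchurKneser

namespace SchurKneser

/-! ### The odd graph: trace norm, closed forms and logarithmic bound. -/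

section Kneser

open Finset Polynomial

lemma kneserMatrix_isSymm (v n : ℕ) : (kneserMatrix v n).IsSymm :=
  (kneserGraph v n).isSymm_adjMatrix

lemma kneserMatrix_isHermitian (v n : ℕ) : (kneserMatrix v n).IsHermitian := by
  ext x y
  rw [Matrix.conjTranspose_apply, kneserMatrix, SimpleGraph.adjMatrix_apply,
    SimpleGraph.adjMatrix_apply]
  simp only [(kneserGraph v n).adj_comm y x]
  split_ifs <;> simp

lemma kneserMatrix_mem_commutant (v n : ℕ) : kneserMatrix v n ∈ kneserCommutant v n := by
  refine mem_commutant_iff.2 fun g x y => ?_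
  have h : (kneserGraph v n).Adj (g • x) (g • y) ↔ (kneserGraph v n).Adj x y := by
    simp only [kneserGraph, ne_eq, Set.powersetCard.coe_smul, smul_left_cancel_iff,
      disjoint_iff_inter_eq_empty, ← smul_finset_inter, smul_finset_eq_empty]
  rw [kneserMatrix, SimpleGraph.adjMatrix_apply, SimpleGraph.adjMatrix_apply]
  simp only [h]

lemma kneserMatrix_eq_submatrix {n : ℕ} (hn : 1 ≤ n)
    (e : Set.powersetCard (Fin (2 * n + 1)) n ≃ Set.powersetCard (Fin (2 * n + 1)) (n + 1))
    (he : ∀ y, (e y : Finset (Fin (2 * n + 1))) = (y : Finset (Fin (2 * n + 1)))ᶜ) :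
    kneserMatrix (2 * n + 1) n = (inclusionMatrix (2 * n + 1) n (n + 1)).submatrix id e := by
  ext x y
  rw [kneserMatrix, SimpleGraph.adjMatrix_apply, Matrix.submatrix_apply, inclusionMatrix,
    Matrix.of_apply, he, id]
  have h : (kneserGraph (2 * n + 1) n).Adj x y ↔
      Disjoint (x : Finset (Fin (2 * n + 1))) (y : Finset (Fin (2 * n + 1))) := by
    -- A self-disjoint vertex would be empty, which `n ≥ 1` forbids.
    refine ⟨fun h => h.2, fun h => ⟨?_, h⟩⟩
    rintro rfl
    have h0 := Set.powersetCard.card_eq x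
    rw [disjoint_self.1 h, bot_eq_empty, card_empty] at h0
    omega
  simp only [h, subset_compl_iff_disjoint_right]

lemma charpoly_kneserMatrix_sq {n : ℕ} (hn : 1 ≤ n) :
    (kneserMatrix (2 * n + 1) n ^ 2).charpoly =
      ∏ i ∈ range (n + 1), (X - C (((n : ℂ) + 1 - i) ^ 2)) ^ layerMult (2 * n + 1) i := by
  let e : Set.powersetCard (Fin (2 * n + 1)) n ≃ Set.powersetCard (Fin (2 * n + 1)) (n + 1) :=
    Set.powersetCard.compl (by rw [Fintype.card_fin]; omega)
  have he := kneserMatrix_eq_submatrix hn e fun y => Set.powersetCard.coe_compl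
  have hsq : kneserMatrix (2 * n + 1) n ^ 2 = inclusionMatrix (2 * n + 1) n (n + 1) *
      (inclusionMatrix (2 * n + 1) n (n + 1))ᵀ := by
    rw [sq]
    nth_rw 2 [← kneserMatrix_isSymm]
    rw [he, Matrix.transpose_submatrix, Matrix.submatrix_mul_equiv, Matrix.submatrix_id_id]
  rw [hsq, charpoly_inclusionMatrix_mul_transpose _ _ (by omega)]
  refine prod_congr rfl fun i _ => ?_
  congr 3
  push_cast
  ring

/-- The trace norm of the adjacency matrix of the odd graph. -/
theorem sum_abs_eigenvalues_kneserMatrix {n : ℕ} (hn : 1 ≤ n) :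
    ∑ k, |(kneserMatrix_isHermitian (2 * n + 1) n).eigenvalues k| = 2 ^ (2 * n) := by
  set hT := kneserMatrix_isHermitian (2 * n + 1) n
  have hsq : cfc (fun t : ℝ => t ^ 2) (kneserMatrix (2 * n + 1) n) =
      kneserMatrix (2 * n + 1) n ^ 2 := cfc_pow_id (R := ℝ) _ 2 hT.isSelfAdjoint
  have hchar := hT.charpoly_cfc_eq (fun t : ℝ => t ^ 2)
  rw [hsq, charpoly_kneserMatrix_sq hn] at hchar
  have hroots := congrArg Polynomial.roots hchar
  rw [Polynomial.roots_prod _ _ (prod_ne_zero_iff.2 fun i _ => pow_ne_zero _ (X_sub_C_ne_zero _)),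
    Polynomial.roots_prod _ _ (prod_ne_zero_iff.2 fun i _ => X_sub_C_ne_zero _)] at hroots
  simp only [roots_pow, roots_X_sub_C] at hroots
  -- Square roots of the eigenvalues of `T²` are the absolute eigenvalues of `T`, so their signs are
  -- never needed.
  have hsum := congrArg (fun s : Multiset ℂ => (s.map fun z => √z.re).sum) hroots
  simp only [Multiset.map_bind, Multiset.sum_bind, Multiset.map_nsmul, Multiset.map_singleton,
    Multiset.sum_nsmul, Multiset.sum_singleton] at hsum
  change ∑ i ∈ range (n + 1), _ = ∑ k, _ at hsum
  have hr : ∀ k, √((((hT.eigenvalues k) ^ 2 : ℝ) : ℂ).re) = |hT.eigenvalues k| := fun k => by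
    rw [Complex.ofReal_re, Real.sqrt_sq_eq_abs]
  have hl : ∀ i ∈ range (n + 1), layerMult (2 * n + 1) i • √((((n : ℂ) + 1 - i) ^ 2).re) =
      (layerMult (2 * n + 1) i : ℝ) * ((n : ℝ) + 1 - i) := fun i hi => by
    have hi' : (i : ℝ) ≤ n := by exact_mod_cast Nat.lt_succ_iff.1 (mem_range.1 hi)
    have : ((n : ℂ) + 1 - i) ^ 2 = ((((n : ℝ) + 1 - i) ^ 2 : ℝ) : ℂ) := by push_cast; ring
    rw [this, Complex.ofReal_re, Real.sqrt_sq (by linarith), nsmul_eq_mul]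
  rw [sum_congr rfl hl, sum_layerMult _ _ (by omega)] at hsum
  refine ((sum_congr rfl fun k _ => (hr k).symm).trans hsum.symm).trans ?_
  rw [pow_mul]
  norm_num
  -- The lower half of row `2n+1` of Pascal's triangle sums to `4^n`.
  exact_mod_cast Nat.sum_range_choose_halfway n

lemma two_pow_div_choose_eq_prod (n : ℕ) :
    (2 : ℝ) ^ (2 * n) / ((2 * n + 1).choose n : ℝ) =
      ∏ i ∈ Icc 1 n, (1 + 1 / (2 * (i : ℝ) + 1)) := by
  induction n with
  | zero => simp
  | succ n ih =>
    rw [prod_Icc_succ_top (by omega), ← ih]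
    have h : ((2 * (n + 1) + 1).choose (n + 1) : ℝ) * (2 * n + 4) =
        (2 * n + 1).choose n * (4 * (2 * n + 3)) := by
      have h1 := Nat.add_one_mul_choose_eq (2 * n + 2) n
      have h2 := Nat.choose_mul_succ_eq (2 * n + 1) n
      have e : 2 * n + 1 + 1 - n = n + 2 := by omega
      rw [e] at h2
      have h1' : ((2 * n + 3 : ℕ) : ℝ) * ((2 * n + 2).choose n : ℝ) =
        ((2 * (n + 1) + 1).choose (n + 1) : ℝ) * (n + 1 : ℕ) := by exact_mod_cast h1
      have h2' : ((2 * n + 1).choose n : ℝ) * (2 * n + 1 + 1 : ℕ) =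
        ((2 * n + 2).choose n : ℝ) * (n + 2 : ℕ) := by exact_mod_cast h2
      push_cast at h1' h2'
      have hn : (n : ℝ) + 1 ≠ 0 := by positivity
      apply mul_right_cancel₀ hn
      linear_combination (-2 * ((n : ℝ) + 2)) * h1' - (2 * (2 * (n : ℝ) + 3)) * h2'
    have p1 : ((2 * (n + 1) + 1).choose (n + 1) : ℝ) ≠ 0 := by
      exact_mod_cast (Nat.choose_pos (by omega)).ne'
    have p2 : ((2 * n + 1).choose n : ℝ) ≠ 0 := by
      exact_mod_cast (Nat.choose_pos (by omega)).ne'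
    have p3 : (2 * (n : ℝ) + 3) ≠ 0 := by positivity
    have hf : 1 + 1 / (2 * ((n + 1 : ℕ) : ℝ) + 1) = (2 * n + 4) / (2 * n + 3) := by
      push_cast
      rw [show 2 * ((n : ℝ) + 1) + 1 = 2 * n + 3 by ring]
      field_simp
      ring
    rw [hf, div_mul_div_comm, div_eq_div_iff p1 (mul_ne_zero p2 p3)]
    linear_combination (-(2 : ℝ) ^ (2 * n)) * h

/-- From `n` to `n+1` the left side grows by at most `1/(2n+3)`, since `log x ≤ x - 1`, while the
product `P ≥ 1` grows by `P/(2n+3)`. Strictness comes from the base case `log 3 < 2`. -/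
lemma half_log_lt_prod (n : ℕ) :
    1 / 2 * Real.log (2 * (n : ℝ) + 3) < ∏ i ∈ Icc 1 n, (1 + 1 / (2 * (i : ℝ) + 1)) := by
  induction n with
  | zero =>
    have h : Real.log (3 / 2) < 3 / 2 - 1 := Real.log_lt_sub_one_of_pos (by norm_num) (by norm_num)
    have h2 := Real.log_two_lt_d9
    have h3 : Real.log 3 = Real.log (3 / 2) + Real.log 2 := by
      rw [← Real.log_mul (by norm_num) (by norm_num)]; norm_num
    simp only [Nat.cast_zero, mul_zero, zero_add, h3]
    simp
    linarith
  | succ n ih =>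
    rw [prod_Icc_succ_top (by omega)]
    set P := ∏ i ∈ Icc 1 n, (1 + 1 / (2 * (i : ℝ) + 1)) with hP
    have h1 : 1 ≤ P := by
      refine le_trans (by simp) (prod_le_prod (fun _ _ => zero_le_one) fun i _ => ?_) (b :=
        ∏ i ∈ Icc 1 n, (1 : ℝ))
      have : 0 ≤ 1 / (2 * (i : ℝ) + 1) := by positivity
      linarith
    have hpos : (0 : ℝ) < 2 * n + 3 := by positivity
    have hpos' : (0 : ℝ) < 2 * n + 5 := by positivity
    have h2 : Real.log ((2 * n + 5) / (2 * n + 3)) ≤ (2 * n + 5) / (2 * n + 3) - 1 :=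
      Real.log_le_sub_one_of_pos (by positivity)
    rw [Real.log_div hpos'.ne' hpos.ne'] at h2
    have h3 : ((2 : ℝ) * n + 5) / (2 * n + 3) - 1 = 2 * (1 / (2 * n + 3)) := by
      field_simp; ring
    have e1 : 2 * ((n + 1 : ℕ) : ℝ) + 3 = 2 * n + 5 := by push_cast; ring
    have e2 : 2 * ((n + 1 : ℕ) : ℝ) + 1 = 2 * n + 3 := by push_cast; ring
    rw [e1, e2]
    have h4 : 0 ≤ 1 / ((2 : ℝ) * n + 3) := by positivity
    nlinarith

end Kneser

end SchurKneser

theorem theorem5p5 (n : ℕ) (hn : 1 ≤ n) :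
    SchurKneser.schurNorm (SchurKneser.kneserMatrix (2 * n + 1) n) =
        SchurKneser.schurNormOn (SchurKneser.kneserMatrix (2 * n + 1) n)
          (Subalgebra.toSubmodule (SchurKneser.kneserCommutant (2 * n + 1) n)) ∧
      SchurKneser.schurNorm (SchurKneser.kneserMatrix (2 * n + 1) n) =
        (2 : ℝ) ^ (2 * n) / ((2 * n + 1).choose n : ℝ) ∧
      (2 : ℝ) ^ (2 * n) / ((2 * n + 1).choose n : ℝ) =
        (∏ i ∈ Finset.Icc 1 n, (2 * (i : ℝ) + 2)) / ∏ i ∈ Finset.Icc 1 n, (2 * (i : ℝ) + 1) ∧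
      (2 : ℝ) ^ (2 * n) / ((2 * n + 1).choose n : ℝ) =
        ∏ i ∈ Finset.Icc 1 n, (1 + 1 / (2 * (i : ℝ) + 1)) ∧
      (2 : ℝ) ^ (2 * n) / ((2 * n + 1).choose n : ℝ) > 1 / 2 * Real.log (2 * (n : ℝ) + 3) := by
  have hprod := SchurKneser.two_pow_div_choose_eq_prod n
  have : Nonempty (Set.powersetCard (Fin (2 * n + 1)) n) := by
    rw [← Fintype.card_pos_iff, SchurKneser.card_powersetCard_fin]
    exact Nat.choose_pos (by omega)
  have : MulAction.IsPretransitive (Equiv.Perm (Fin (2 * n + 1)))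
      (Set.powersetCard (Fin (2 * n + 1)) n) := Set.powersetCard.isPretransitive
  obtain ⟨h1, h2⟩ := SchurKneser.schurNorm_eq_of_isPretransitive
    (SchurKneser.kneserMatrix_isHermitian (2 * n + 1) n)
    (SchurKneser.kneserMatrix_isSymm (2 * n + 1) n)
    (SchurKneser.kneserMatrix_mem_commutant (2 * n + 1) n)
  refine ⟨h1.trans h2.symm, ?_, ?_, hprod, ?_⟩
  · rw [h1, SchurKneser.sum_abs_eigenvalues_kneserMatrix hn, SchurKneser.card_powersetCard_fin]
  · rw [hprod, ← Finset.prod_div_distrib]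
    refine Finset.prod_congr rfl fun i _ => ?_
    have : (2 * (i : ℝ) + 1) ≠ 0 := by positivity
    field_simp
    ring
  · rw [hprod]
    exact SchurKneser.half_log_lt_prod n
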